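/- Let $\Omega\subset\mathbb{R}^d$ be open, let $\lambda$ be the Lebesgue measure on $\Omega$, and let $|\cdot|$ be the Euclidean norm. For $u\in L_1(\Omega)$ let $$|Du|(\Omega)=\sup\Big\{\int_\Omega u\,\operatorname{div}\psi\,d\lambda \;:\; \psi\in C^1_c(\Omega;\mathbb{R}^d),\ |\psi|\le 1\Big\},$$ let $BV(\Omega)$ be the set of all $u\in L_1(\Omega)$ with $|Du|(\Omega)<\infty$, and let $\|u\|_{BV(\Omega)}=\|u\|_{L_1(\Omega)}+|Du|(\Omega)$. Let $u\in BV(\Omega)$, let $\phi,\varphi:\Omega\to\Omega$, and let $\Phi^s:\Omega\to\Omega$, $0\le s\le 1$, be Lebesgue measurable maps with $\Phi^0=\phi$ and $\Phi^1=\varphi$ such that for every $x\in\Omega$ the curve $s\mapsto\Phi^s(x)$ is differentiable on $[0,1]$ (one-sidedly at the end points). Assume that for constants $c,C\ge 0$ $$\Phi^s_*\lambda(A)=\lambda\big((\Phi^s)^{-1}(A)\big)\le c\,\lambda(A)\quad\text{for all Lebesgue measurable } A\subset\Omega \text{ and } 0\le s\le 1,$$ $$\sup_{0\le s\le 1,\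 x\in\Omega}|\partial_s\Phi^s(x)|\le C\,\|\phi-\varphi\|_{L_\infty(\Omega)}.$$ Then $u\circ\phi-u\circ\varphi\in L_1(\Omega)$ and $$\|u\circ\phi-u\circ\varphi\|_{L_1(\Omega)}\le c\,C\,|Du|(\Omega)\,\|\phi-\varphi\|_{L_\infty(\Omega)},$$ and in particular $$\|u\circ\phi-u\circ\varphi\|_{L_1(\Omega)}\le c\,C\,\|u\|_{BV(\Omega)}\,\|\phi-\varphi\|_{L_\infty(\Omega)}.$$ (Norms take values in $[0,\infty]$, with $0\cdot\infty=0$.) -/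

import Mathlib

open MeasureTheory Set
open scoped NNReal ENNReal

namespace BVPerturbation

noncomputable section

/-- The divergence of a vector field on `ℝ^d`. -/
def divergence {d : ℕ} (ψ : EuclideanSpace ℝ (Fin d) → EuclideanSpace ℝ (Fin d))
    (x : EuclideanSpace ℝ (Fin d)) : ℝ :=
  ∑ i : Fin d, (fderiv ℝ ψ x (EuclideanSpace.single i 1)) i

/-- The `C¹` vector fields with compact support inside `Ω` and Euclidean norm at most `1`. -/
structure IsTestField {d : ℕ} (Ω : Set (EuclideanSpace ℝ (Fin d)))
    (ψ : EuclideanSpace ℝ (Fin d) → EuclideanSpace ℝ (Fin d)) : Prop where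
  contDiff : ContDiff ℝ 1 ψ
  hasCompactSupport : HasCompactSupport ψ
  tsupport_subset : tsupport ψ ⊆ Ω
  norm_le_one : ∀ x, ‖ψ x‖ ≤ 1

/-- The total variation `|Du|(Ω) = sup { ∫_Ω u div ψ }` over all test fields `ψ`. The null field
is a test field, so taking positive parts does not change the supremum. -/
def totalVariation {d : ℕ} (u : EuclideanSpace ℝ (Fin d) → ℝ)
    (Ω : Set (EuclideanSpace ℝ (Fin d))) : ℝ≥0∞ :=
  ⨆ (ψ : EuclideanSpace ℝ (Fin d) → EuclideanSpace ℝ (Fin d)) (_ : IsTestField Ω ψ),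
    ENNReal.ofReal (∫ x in Ω, u x * divergence ψ x)

/-- The space `BV(Ω)`: integrable functions on `Ω` of finite total variation. -/
structure MemBV {d : ℕ} (u : EuclideanSpace ℝ (Fin d) → ℝ)
    (Ω : Set (EuclideanSpace ℝ (Fin d))) : Prop where
  integrableOn : IntegrableOn u Ω
  totalVariation_lt_top : totalVariation u Ω < ∞

/-- The norm `‖u‖_{BV(Ω)} = ‖u‖_{L₁(Ω)} + |Du|(Ω)`. -/
def bvNorm {d : ℕ} (u : EuclideanSpace ℝ (Fin d) → ℝ)
    (Ω : Set (EuclideanSpace ℝ (Fin d))) : ℝ≥0∞ :=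
  eLpNorm u 1 (volume.restrict Ω) + totalVariation u Ω

end

end BVPerturbation

/-!
The function `u` is replaced by mollifications `v n = ρ n ⋆ (1_Ω u)`, which converge to `u` almost
everywhere. Moving the mollification onto the test field (`integral_fderiv_mollify`) shows that
`v n` has total variation at most `|Du|(Ω)` on compact sets whose distance to the complement of
`Ω` is more than twice the support radius of the kernel (`lintegral_enorm_fderiv_mollify_le`).
No global smooth approximation on `Ω` is required: for each `x ∈ Ω` the curve `s ↦ Φ s x` has
compact image in `Ω`, hence it lies in the region `O n` where `D(v n)` is controlled as soon as
`n` is large. From then on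
`|v n (Φ 1 x) - v n (Φ 0 x)| ≤ L ∫₀¹ 1_{O n} |D(v n)| (Φ s x) ds`,
where `L` bounds the speed. By Tonelli and the bound on the push-forward measures, the integral of
the right-hand side over `Ω` is at most `c L |Du|(Ω)`. On the left, almost everywhere convergence
passes to the compositions because `Φ 0` and `Φ 1` pull null sets back to null sets, so Fatou's
lemma gives the estimate (`lintegral_enorm_comp_sub_le`). Tonelli requires joint measurability of
`Φ`, which holds up to a null set by continuity in `s` (`exists_measurable_uncurry_of_continuous`).

The speed bound `C ‖φ - ϕ‖_∞` may be infinite. The right-hand side of the estimate is then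
infinite as well, unless `c = 0`, in which case `Ω` is null, or `|Du|(Ω) = 0`, in which case
`D(v n)` vanishes on `O n` and the speed plays no role.
-/

namespace BVPerturbation

/-! ### Families of curves and exhaustions by compact sets -/

/-- A Carathéodory family whose members are only almost everywhere measurable, and which is
continuous in the parameter, agrees for almost all points, simultaneously for all parameters,
with a jointly measurable family. -/
theorem exists_measurable_uncurry_of_continuous {α X : Type*} [MeasurableSpace α]
    [TopologicalSpace X] [TopologicalSpace.PseudoMetrizableSpace X] [MeasurableSpace X]
    [BorelSpace X] [Nonempty X] [SecondCountableTopology X] {μ : Measure α}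
    {F : ℝ → α → X} (hF : ∀ s, AEMeasurable (F s) μ) (hc : ∀ᵐ x ∂μ, Continuous fun s => F s x) :
    ∃ Ψ : ℝ → α → X, Measurable (Function.uncurry Ψ) ∧ ∀ᵐ x ∂μ, ∀ s, Ψ s x = F s x := by
  have hae : ∀ᵐ x ∂μ, (Continuous fun s => F s x) ∧
      ∀ q : ℚ, F q x = (hF q).mk (F q) x := by
    filter_upwards [hc, ae_all_iff.2 fun q : ℚ => (hF q).ae_eq_mk] with x h1 h2 using ⟨h1, h2⟩
  obtain ⟨E, hE, hEm, hEμ⟩ := exists_measurable_superset_of_null hae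
  -- `E` is a measurable null set off which the curves are continuous and agree, at rational
  -- parameters, with the measurable modifications; the values on `E` are irrelevant.
  have hgood : ∀ x ∉ E, (Continuous fun s => F s x) ∧ ∀ q : ℚ, F q x = (hF q).mk (F q) x :=
    fun x hx => by_contra fun h => hx (hE h)
  classical
  let z : X := Classical.arbitrary X
  let Ψ : ℝ → α → X := fun s => E.piecewise (fun _ => z) (F s)
  have hΨc : ∀ x, Continuous fun s => Ψ s x := fun x => by
    by_cases hx : x ∈ E
    · simpa [Ψ, hx] using continuous_const
    · simpa [Ψ, hx] using (hgood x hx).1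
  have hΨq : ∀ q : ℚ, Measurable (Ψ q) := fun q => by
    have : Ψ q = E.piecewise (fun _ => z) ((hF q).mk (F q)) := by
      ext1 x
      by_cases hx : x ∈ E
      · simp [Ψ, hx]
      · simp [Ψ, hx, (hgood x hx).2 q]
    rw [this]
    exact measurable_const.piecewise hEm (hF q).measurable_mk
  have hΨm : ∀ s, Measurable (Ψ s) := fun s => by
    obtain ⟨t, ht, hts⟩ := mem_closure_iff_seq_limit.1 (Rat.denseRange_cast (𝕜 := ℝ) s)
    choose q hq using ht
    refine measurable_of_tendsto_metrizable (f := fun n => Ψ (q n)) (fun n => hΨq (q n)) ?_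
    rw [tendsto_pi_nhds]
    intro x
    simp only [hq]
    exact ((hΨc x).tendsto s).comp hts
  refine ⟨Ψ, measurable_uncurry_of_continuous_of_measurable hΨc hΨm, ?_⟩
  filter_upwards [compl_mem_ae_iff.2 hEμ] with x hx s
  simp [Ψ, show x ∉ E from hx]

/-- The mean value inequality for a `C¹` function along a differentiable curve. The derivative of
the curve need not be integrable; only the product with `L` in place of the speed is integrated. -/
theorem enorm_sub_le_lintegral_fderiv {E : Type*} [NormedAddCommGroup E] [NormedSpace ℝ E]
    {v : E → ℝ} (hv : ContDiff ℝ 1 v) {γ : ℝ → E} (hγ : DifferentiableOn ℝ γ (Icc 0 1))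
    {L : ℝ≥0} (hL : ∀ s ∈ Icc (0 : ℝ) 1,
      ‖fderiv ℝ v (γ s)‖ * ‖derivWithin γ (Icc 0 1) s‖ ≤ L * ‖fderiv ℝ v (γ s)‖) :
    ‖v (γ 1) - v (γ 0)‖ₑ ≤ L * ∫⁻ s in Icc (0 : ℝ) 1, ‖fderiv ℝ v (γ s)‖ₑ := by
  have hfc := hv.continuous_fderiv one_ne_zero
  -- Freezing the curve outside `[0, 1]` makes the integrand continuous on all of `ℝ`.
  let g : ℝ → ℝ := fun s => L * ‖fderiv ℝ v (γ (projIcc 0 1 zero_le_one s))‖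
  have hg : Continuous g := by
    have : Continuous fun s => γ (projIcc (0 : ℝ) 1 zero_le_one s) :=
      (continuousOn_iff_continuous_domRestrict.1 hγ.continuousOn).comp continuous_projIcc
    exact continuous_const.mul (hfc.comp this).norm
  have hgs : ∀ s ∈ Icc (0 : ℝ) 1, g s = L * ‖fderiv ℝ v (γ s)‖ := fun s hs => by
    simp [g, projIcc_of_mem _ hs]
  have hB : ∀ s, HasDerivAt (fun s => ∫ t in (0 : ℝ)..s, g t) (g s) s := fun s =>
    intervalIntegral.integral_hasDerivAt_right (hg.intervalIntegrable _ _)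
      (hg.stronglyMeasurableAtFilter _ _) hg.continuousAt
  have h := image_norm_le_of_norm_deriv_right_le_deriv_boundary' (a := 0) (b := 1)
    (f := fun s => v (γ s) - v (γ 0))
    (f' := fun s => fderiv ℝ v (γ s) (derivWithin γ (Icc 0 1) s))
    (B := fun s => ∫ t in (0 : ℝ)..s, g t) (B' := g)
    ((hv.continuous.comp_continuousOn hγ.continuousOn).sub continuousOn_const)
    (fun s hs => by
      have h2 := (hv.differentiable one_ne_zero (γ s)).hasFDerivAt
      have h3 := (hγ s (Ico_subset_Icc_self hs)).hasDerivWithinAt.mono_of_mem_nhdsWithin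
        (Icc_mem_nhdsGE_of_mem hs)
      exact (h2.comp_hasDerivWithinAt s h3).sub_const _)
    (by simp) (fun s _ => (hB s).continuousAt.continuousWithinAt)
    (fun s _ => (hB s).hasDerivWithinAt)
    (fun s hs => by
      rw [hgs s (Ico_subset_Icc_self hs)]
      exact (ContinuousLinearMap.le_opNorm _ _).trans (hL s (Ico_subset_Icc_self hs)))
    (right_mem_Icc.2 zero_le_one)
  have hgi : IntegrableOn g (Icc 0 1) := hg.integrableOn_Icc
  rw [← ofReal_norm]
  refine (ENNReal.ofReal_le_ofReal h).trans ?_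
  rw [intervalIntegral.integral_of_le zero_le_one, ← integral_Icc_eq_integral_Ioc,
    ofReal_integral_eq_lintegral_ofReal hgi (.of_forall fun s => by positivity),
    ← lintegral_const_mul' _ _ ENNReal.coe_ne_top]
  refine (setLIntegral_congr_fun measurableSet_Icc fun s hs => ?_).le
  simp only [hgs s hs]
  rw [ENNReal.ofReal_mul (NNReal.coe_nonneg L), ofReal_norm, ENNReal.ofReal_coe_nnreal]

/-- An open set has an exhaustion by compact sets whose interiors absorb every compact subset. -/
theorem exists_isCompact_exhaustion {X : Type*} [TopologicalSpace X] [LocallyCompactSpace X]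
    [SecondCountableTopology X] {Ω : Set X} (hΩ : IsOpen Ω) :
    ∃ K : ℕ → Set X, (∀ n, IsCompact (K n)) ∧ (∀ n, K n ⊆ Ω) ∧
      ∀ S, IsCompact S → S ⊆ Ω → ∀ᶠ n in Filter.atTop, S ⊆ interior (K n) := by
  have := hΩ.locallyCompactSpace
  let T := CompactExhaustion.choice Ω
  refine ⟨fun n => Subtype.val '' T n, fun n => (T.isCompact n).image continuous_subtype_val,
    fun n => by simp, fun S hS hSΩ => ?_⟩
  have hS' : IsCompact (Subtype.val ⁻¹' S : Set Ω) := by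
    rw [Subtype.isCompact_iff, Subtype.image_preimage_coe, inter_eq_right.2 hSΩ]; exact hS
  obtain ⟨n, hn⟩ := T.exists_superset_of_isCompact hS'
  filter_upwards [Filter.eventually_gt_atTop n] with m hm
  have h1 : Subtype.val '' interior (T m) ⊆ interior (Subtype.val '' T m) :=
    interior_maximal (image_mono interior_subset)
      (hΩ.isOpenMap_subtype_val _ isOpen_interior)
  intro x hx
  exact h1 ⟨⟨x, hSΩ hx⟩, T.subset_interior hm (hn hx), rfl⟩

/-! ### Mollification of functions of bounded variation -/

section Mollification

variable {d : ℕ} {Ω : Set (EuclideanSpace ℝ (Fin d))} {u : EuclideanSpace ℝ (Fin d) → ℝ}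
  (ρ : ContDiffBump (0 : EuclideanSpace ℝ (Fin d)))

/-- The mollification `ρ ⋆ (1_Ω u)` of a function given on `Ω`, with `ρ` normalized to integral
one. -/
noncomputable def mollify (ρ : ContDiffBump (0 : EuclideanSpace ℝ (Fin d)))
    (Ω : Set (EuclideanSpace ℝ (Fin d))) (u : EuclideanSpace ℝ (Fin d) → ℝ) :
    EuclideanSpace ℝ (Fin d) → ℝ :=
  convolution (ρ.normed volume) (Ω.indicator u) (ContinuousLinearMap.lsmul ℝ ℝ) volume

theorem contDiff_mollify (hΩ : MeasurableSet Ω) (hu : IntegrableOn u Ω) :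
    ContDiff ℝ 1 (mollify ρ Ω u) :=
  ρ.hasCompactSupport_normed.contDiff_convolution_left (n := 1) _ ρ.contDiff_normed
    ((integrable_indicator_iff hΩ).2 hu).locallyIntegrable

theorem fderiv_convolution_normed_apply {F : Type*} [NormedAddCommGroup F] [NormedSpace ℝ F]
    [CompleteSpace F]
    {g : EuclideanSpace ℝ (Fin d) → F} (hg : LocallyIntegrable g) (x w : EuclideanSpace ℝ (Fin d)) :
    fderiv ℝ (convolution (ρ.normed volume) g (ContinuousLinearMap.lsmul ℝ ℝ) volume) x w
      = ∫ y, fderiv ℝ (ρ.normed volume) (x - y) w • g y := by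
  have hc : ContDiff ℝ 1 (ρ.normed volume) := ρ.contDiff_normed
  rw [(ρ.hasCompactSupport_normed.hasFDerivAt_convolution_left _ hc hg x).fderiv,
    convolution_eq_swap, ContinuousLinearMap.integral_apply]
  · simp [ContinuousLinearMap.precompL_apply]
  have := (HasCompactSupport.convolutionExists_left
    (ContinuousLinearMap.precompL (EuclideanSpace ℝ (Fin d))
      (ContinuousLinearMap.lsmul ℝ ℝ : ℝ →L[ℝ] F →L[ℝ] F))
    (ρ.hasCompactSupport_normed.fderiv (𝕜 := ℝ))
    (hc.continuous_fderiv one_ne_zero) hg x).integrable_swap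
  exact this

theorem fderiv_normed_neg (z : EuclideanSpace ℝ (Fin d)) :
    fderiv ℝ (ρ.normed volume) (-z) = -fderiv ℝ (ρ.normed volume) z := by
  have h : (fun y => ρ.normed volume (-y)) = ρ.normed volume := funext ρ.normed_neg
  have hd : HasFDerivAt (ρ.normed volume) (fderiv ℝ (ρ.normed volume) (-z)) (-z) :=
    ((ρ.contDiff_normed (n := 1)).differentiable one_ne_zero _).hasFDerivAt
  have := (hd.comp z (hasFDerivAt_id z).neg).fderiv
  rw [show ρ.normed volume ∘ Neg.neg = ρ.normed volume from h] at this
  rw [this]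
  ext w
  simp

/-- The divergence of a mollified vector field, with all derivatives moved to the kernel. -/
theorem divergence_convolution_normed {ψ : EuclideanSpace ℝ (Fin d) → EuclideanSpace ℝ (Fin d)}
    (hψ : Continuous ψ) (hψc : HasCompactSupport ψ) (y : EuclideanSpace ℝ (Fin d)) :
    divergence (convolution (ρ.normed volume) ψ (ContinuousLinearMap.lsmul ℝ ℝ) volume) y
      = ∫ x, fderiv ℝ (ρ.normed volume) (y - x) (ψ x) := by
  have hc : ContDiff ℝ 1 (ρ.normed volume) := ρ.contDiff_normed
  have hfc := hc.continuous_fderiv one_ne_zero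
  have hi : ∀ w, Integrable fun x => fderiv ℝ (ρ.normed volume) (y - x) w • ψ x := fun w =>
    Continuous.integrable_of_hasCompactSupport
      (((hfc.comp (continuous_const.sub continuous_id)).clm_apply continuous_const).smul hψ)
      (hψc.mono fun x hx h => hx (by simp [h]))
  simp only [divergence, fderiv_convolution_normed_apply ρ hψ.locallyIntegrable]
  have hp : ∀ i : Fin d,
      (∫ x, fderiv ℝ (ρ.normed volume) (y - x) (EuclideanSpace.single i 1) • ψ x) i
      = ∫ x, fderiv ℝ (ρ.normed volume) (y - x) (EuclideanSpace.single i 1) * ψ x i := fun i =>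
    ((EuclideanSpace.proj (𝕜 := ℝ) i : EuclideanSpace ℝ (Fin d) →L[ℝ] ℝ).integral_comp_comm
      (hi (EuclideanSpace.single i 1))).symm
  simp only [hp]
  have hpi : ∀ i : Fin d, Integrable fun x =>
      fderiv ℝ (ρ.normed volume) (y - x) (EuclideanSpace.single i 1) * ψ x i := fun i =>
    (EuclideanSpace.proj (𝕜 := ℝ) i : EuclideanSpace ℝ (Fin d) →L[ℝ] ℝ).integrable_comp
      (hi (EuclideanSpace.single i 1))
  rw [← integral_finsetSum _ fun i _ => hpi i]
  congr 1 with x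
  conv_rhs => rw [← (EuclideanSpace.basisFun (Fin d) ℝ).sum_repr (ψ x), map_sum]
  simp [mul_comm]

/-- Transposition of mollification: differentiating `ρ ⋆ u` along `ψ` and integrating amounts to
testing the distributional derivative of `u` with the mollified field. Both sides are the same
double integral because `Dρ` is odd. -/
theorem integral_fderiv_mollify (hΩ : MeasurableSet Ω) (hu : IntegrableOn u Ω)
    {ψ : EuclideanSpace ℝ (Fin d) → EuclideanSpace ℝ (Fin d)}
    (hψ : Continuous ψ) (hψc : HasCompactSupport ψ) :
    ∫ x, fderiv ℝ (mollify ρ Ω u) x (ψ x)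
      = -∫ y in Ω, u y *
        divergence (convolution (ρ.normed volume) ψ (ContinuousLinearMap.lsmul ℝ ℝ) volume) y := by
  have hc : ContDiff ℝ 1 (ρ.normed volume) := ρ.contDiff_normed
  have hfc := hc.continuous_fderiv one_ne_zero
  have hU : Integrable (Ω.indicator u) := (integrable_indicator_iff hΩ).2 hu
  obtain ⟨B, hB⟩ := (ρ.hasCompactSupport_normed (μ := volume)).fderiv (𝕜 := ℝ)
    |>.exists_bound_of_continuous hfc
  have hint : Integrable (Function.uncurry fun x y =>
      fderiv ℝ (ρ.normed volume) (x - y) (ψ x) * Ω.indicator u y)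
      ((volume : Measure (EuclideanSpace ℝ (Fin d))).prod volume) := by
    have h1 : Integrable (fun z : EuclideanSpace ℝ (Fin d) × EuclideanSpace ℝ (Fin d) =>
        (B * ‖ψ z.1‖) * Ω.indicator u z.2) (volume.prod volume) :=
      ((hψ.integrable_of_hasCompactSupport hψc).norm.const_mul B).mul_prod hU
    refine h1.mono ?_ (.of_forall fun z => ?_)
    · refine AEStronglyMeasurable.mul ?_ hU.aestronglyMeasurable.comp_snd
      exact Continuous.aestronglyMeasurable (by fun_prop)
    · simp only [Function.uncurry, norm_mul, norm_norm]
      gcongr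
      exact ((fderiv ℝ (ρ.normed volume) (z.1 - z.2)).le_opNorm _).trans
        (mul_le_mul_of_nonneg_right ((hB _).trans (le_abs_self B)) (norm_nonneg _))
  have h1 : ∀ x, fderiv ℝ (mollify ρ Ω u) x (ψ x)
      = ∫ y, fderiv ℝ (ρ.normed volume) (x - y) (ψ x) * Ω.indicator u y := fun x =>
    fderiv_convolution_normed_apply ρ hU.locallyIntegrable x (ψ x)
  simp only [h1, divergence_convolution_normed ρ hψ hψc]
  rw [integral_integral_swap hint, ← integral_neg, ← integral_indicator hΩ]
  congr 1 with y
  have h2 : ∀ x, fderiv ℝ (ρ.normed volume) (x - y) (ψ x)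
      = -fderiv ℝ (ρ.normed volume) (y - x) (ψ x) := fun x => by
    rw [← neg_sub y x, fderiv_normed_neg]; rfl
  simp only [h2, neg_mul, integral_neg, integral_mul_const]
  by_cases hy : y ∈ Ω <;> simp [hy, mul_comm]

/-- Mollification of a continuous field with `|ψ| ≤ 1` gives a test field for `Ω` once the support
of the kernel is small enough. -/
theorem isTestField_neg_convolution {ψ : EuclideanSpace ℝ (Fin d) → EuclideanSpace ℝ (Fin d)}
    (hψ : Continuous ψ) (hψc : HasCompactSupport ψ) (hψ1 : ∀ x, ‖ψ x‖ ≤ 1)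
    (hsupp : Metric.cthickening ρ.rOut (tsupport ψ) ⊆ Ω) :
    IsTestField Ω
      (-convolution (ρ.normed volume) ψ (ContinuousLinearMap.lsmul ℝ ℝ) volume) where
  contDiff := (ρ.hasCompactSupport_normed.contDiff_convolution_left (n := 1) _ ρ.contDiff_normed
    hψ.locallyIntegrable).neg
  hasCompactSupport := (ρ.hasCompactSupport_normed.convolution _ hψc).neg
  tsupport_subset := by
    refine Subset.trans ?_ hsupp
    refine closure_minimal ?_ Metric.isClosed_cthickening
    rw [Function.support_neg]
    refine (support_convolution_subset_swap _).trans ?_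
    rintro _ ⟨a, ha, b, hb, rfl⟩
    refine Metric.mem_cthickening_of_dist_le _ a _ _ (subset_tsupport _ ha) ?_
    have := subset_tsupport _ hb
    rw [ρ.tsupport_normed_eq] at this
    simpa using this
  norm_le_one x := by
    have := dist_convolution_le (μ := volume) (x₀ := x) (z₀ := 0) (ε := 1) zero_le_one
      (ρ.support_normed_eq (μ := volume)).subset ρ.nonneg_normed
      ρ.integral_normed hψ.aestronglyMeasurable (fun y _ => by simpa using hψ1 y)
    simpa using this

theorem integral_fderiv_mollify_le (hΩ : MeasurableSet Ω) (hu : IntegrableOn u Ω)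
    {ψ : EuclideanSpace ℝ (Fin d) → EuclideanSpace ℝ (Fin d)}
    (hψ : Continuous ψ) (hψc : HasCompactSupport ψ) (hψ1 : ∀ x, ‖ψ x‖ ≤ 1)
    (hsupp : Metric.cthickening ρ.rOut (tsupport ψ) ⊆ Ω) :
    ENNReal.ofReal (∫ x, fderiv ℝ (mollify ρ Ω u) x (ψ x)) ≤ totalVariation u Ω := by
  refine le_trans (le_of_eq ?_)
    (le_iSup₂ (f := fun ψ (_ : IsTestField Ω ψ) =>
      ENNReal.ofReal (∫ x in Ω, u x * divergence ψ x)) _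
      (isTestField_neg_convolution ρ hψ hψc hψ1 hsupp))
  rw [integral_fderiv_mollify ρ hΩ hu hψ hψc, ← integral_neg]
  congr 2 with y
  simp [divergence, fderiv_neg]

/-- Mollification does not increase the total variation: away from the boundary of `Ω` the
`L₁` norm of the derivative of `ρ ⋆ u` is at most `|Du|(Ω)`. The field realizing the norm is
`χ ∇v / √(|∇v|² + δ²)` with a cutoff `χ`, up to an error `δ` in the integrand. -/
theorem lintegral_enorm_fderiv_mollify_le (hΩ : MeasurableSet Ω) (hu : IntegrableOn u Ω)
    {K : Set (EuclideanSpace ℝ (Fin d))} (hK : IsCompact K)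
    (hsupp : Metric.cthickening (2 * ρ.rOut) K ⊆ Ω) :
    ∫⁻ x in K, ‖fderiv ℝ (mollify ρ Ω u) x‖ₑ ≤ totalVariation u Ω := by
  set v := mollify ρ Ω u
  have hvc : Continuous (fderiv ℝ v) :=
    (contDiff_mollify ρ hΩ hu).continuous_fderiv one_ne_zero
  have key : ∀ δ : ℝ, 0 < δ → ∫⁻ x in K, ‖fderiv ℝ v x‖ₑ
      ≤ totalVariation u Ω + ENNReal.ofReal δ * volume K := by
    intro δ hδ
    let χ : EuclideanSpace ℝ (Fin d) → ℝ := fun x => (thickenedIndicator ρ.rOut_pos K x : ℝ)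
    have hχc : Continuous χ :=
      NNReal.continuous_coe.comp (thickenedIndicator ρ.rOut_pos K).continuous
    have hχ0 : ∀ x, 0 ≤ χ x := fun x => NNReal.coe_nonneg _
    have hχ1 : ∀ x, χ x ≤ 1 := fun x => by exact_mod_cast thickenedIndicator_le_one ρ.rOut_pos K x
    let q : EuclideanSpace ℝ (Fin d) → ℝ := fun x => √(‖fderiv ℝ v x‖ ^ 2 + δ ^ 2)
    have hq0 : ∀ x, 0 < q x := fun x => Real.sqrt_pos.2 (by positivity)
    have hqs : ∀ x, q x ^ 2 = ‖fderiv ℝ v x‖ ^ 2 + δ ^ 2 := fun x => Real.sq_sqrt (by positivity)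
    have hqn : ∀ x, ‖fderiv ℝ v x‖ ≤ q x := fun x => Real.le_sqrt_of_sq_le (by nlinarith)
    have hqδ : ∀ x, q x ≤ ‖fderiv ℝ v x‖ + δ := fun x =>
      Real.sqrt_le_iff.2 ⟨by positivity, by nlinarith [norm_nonneg (fderiv ℝ v x)]⟩
    have hqc : Continuous q := by fun_prop
    let ψ : EuclideanSpace ℝ (Fin d) → EuclideanSpace ℝ (Fin d) := fun x =>
      (χ x / q x) • (InnerProductSpace.toDual ℝ _).symm (fderiv ℝ v x)
    have hψc : Continuous ψ :=
      (hχc.div hqc fun x => (hq0 x).ne').smul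
        ((InnerProductSpace.toDual ℝ _).symm.continuous.comp hvc)
    have hψs : tsupport ψ ⊆ Metric.cthickening ρ.rOut K := by
      refine closure_minimal (fun x hx => ?_) Metric.isClosed_cthickening
      refine Metric.thickening_subset_cthickening _ _ ?_
      by_contra hx'
      have h0 : χ x = 0 := by
        simp only [χ, thickenedIndicator_zero ρ.rOut_pos K hx', NNReal.coe_zero]
      exact hx (by simp [ψ, h0])
    have hψcs : HasCompactSupport ψ := hK.cthickening.of_isClosed_subset (isClosed_tsupport _) hψs
    have hψ1 : ∀ x, ‖ψ x‖ ≤ 1 := fun x => by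
      simp only [ψ, norm_smul, LinearIsometryEquiv.norm_map, norm_div, Real.norm_eq_abs,
        abs_of_nonneg (hχ0 x), abs_of_pos (hq0 x)]
      rw [div_mul_eq_mul_div, div_le_one (hq0 x)]
      exact (mul_le_of_le_one_left (norm_nonneg _) (hχ1 x)).trans (hqn x)
    have hψv : ∀ x, fderiv ℝ v x (ψ x) = χ x * (‖fderiv ℝ v x‖ ^ 2 / q x) := fun x => by
      have : fderiv ℝ v x ((InnerProductSpace.toDual ℝ _).symm (fderiv ℝ v x))
          = ‖fderiv ℝ v x‖ ^ 2 := by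
        rw [← InnerProductSpace.toDual_symm_apply, real_inner_self_eq_norm_sq,
          LinearIsometryEquiv.norm_map]
      simp only [ψ, map_smul, this, smul_eq_mul]
      ring
    have hnn : ∀ x, 0 ≤ fderiv ℝ v x (ψ x) := fun x => by
      rw [hψv]; exact mul_nonneg (hχ0 x) (div_nonneg (sq_nonneg _) (hq0 x).le)
    have hψi : Integrable fun x => fderiv ℝ v x (ψ x) := by
      refine Continuous.integrable_of_hasCompactSupport (by fun_prop) ?_
      exact hψcs.mono' fun x hx => subset_tsupport _ fun h => hx (by simp [h])
    have hpt : ∀ x ∈ K, ‖fderiv ℝ v x‖ ≤ fderiv ℝ v x (ψ x) + δ := fun x hx => by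
      have h1 : χ x = 1 := by
        simp only [χ, thickenedIndicator_one ρ.rOut_pos K hx, NNReal.coe_one]
      rw [hψv, h1, one_mul, div_add' _ _ _ (hq0 x).ne', le_div_iff₀ (hq0 x)]
      nlinarith [hqs x, hqn x, hqδ x, norm_nonneg (fderiv ℝ v x)]
    calc ∫⁻ x in K, ‖fderiv ℝ v x‖ₑ
        ≤ ∫⁻ x in K, (ENNReal.ofReal (fderiv ℝ v x (ψ x)) + ENNReal.ofReal δ) := by
          refine setLIntegral_mono' hK.measurableSet fun x hx => ?_
          rw [← ENNReal.ofReal_add (hnn x) hδ.le, ← ofReal_norm]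
          exact ENNReal.ofReal_le_ofReal (hpt x hx)
      _ = (∫⁻ x in K, ENNReal.ofReal (fderiv ℝ v x (ψ x))) + ENNReal.ofReal δ * volume K := by
          rw [lintegral_add_right _ measurable_const, lintegral_const, Measure.restrict_apply_univ]
      _ ≤ (∫⁻ x, ENNReal.ofReal (fderiv ℝ v x (ψ x))) + ENNReal.ofReal δ * volume K := by
          gcongr; exact Measure.restrict_le_self
      _ ≤ totalVariation u Ω + ENNReal.ofReal δ * volume K := by
          rw [← ofReal_integral_eq_lintegral_ofReal hψi (.of_forall hnn)]
          gcongr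
          refine integral_fderiv_mollify_le ρ hΩ hu hψc hψcs hψ1 (Subset.trans ?_ hsupp)
          refine (Metric.cthickening_subset_of_subset _ hψs).trans ?_
          refine (Metric.cthickening_cthickening_subset ρ.rOut_pos.le ρ.rOut_pos.le K).trans ?_
          rw [two_mul]
  refine ENNReal.le_of_forall_pos_le_add fun η hη _ => ?_
  have hKt := hK.measure_lt_top (μ := volume)
  refine (key (η / ((volume K).toReal + 1)) (by positivity)).trans ?_
  gcongr
  rw [show volume K = ENNReal.ofReal (volume K).toReal from (ENNReal.ofReal_toReal hKt.ne).symm,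
    ENNReal.toReal_ofReal ENNReal.toReal_nonneg]
  rw [← ENNReal.ofReal_mul (by positivity), ← ENNReal.ofReal_coe_nnreal]
  refine ENNReal.ofReal_le_ofReal ?_
  rw [div_mul_eq_mul_div, div_le_iff₀ (by positivity)]
  have : (0 : ℝ) ≤ η := η.2
  nlinarith

end Mollification

/-! ### Perturbation estimate -/

section Perturbation

variable {d : ℕ} {Ω : Set (EuclideanSpace ℝ (Fin d))} {u : EuclideanSpace ℝ (Fin d) → ℝ}

/-- Smooth approximations of `u ∈ L₁(Ω)` converging almost everywhere, whose derivatives are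
controlled by `|Du|(Ω)` on open sets `O n` that eventually contain each compact subset of `Ω`. -/
theorem exists_contDiff_approximation (hΩ : IsOpen Ω) (hu : IntegrableOn u Ω) :
    ∃ (v : ℕ → EuclideanSpace ℝ (Fin d) → ℝ) (O : ℕ → Set (EuclideanSpace ℝ (Fin d))),
      (∀ n, ContDiff ℝ 1 (v n)) ∧ (∀ n, IsOpen (O n)) ∧
      (∀ S, IsCompact S → S ⊆ Ω → ∀ᶠ n in Filter.atTop, S ⊆ O n) ∧
      (∀ n, ∫⁻ x in O n, ‖fderiv ℝ (v n) x‖ₑ ≤ totalVariation u Ω) ∧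
      ∀ᵐ x ∂volume.restrict Ω, Filter.Tendsto (fun n => v n x) Filter.atTop (nhds (u x)) := by
  obtain ⟨K, hK, hKΩ, hKS⟩ := exists_isCompact_exhaustion hΩ
  choose δ hδ hδΩ using fun n => (hK n).exists_cthickening_subset_open hΩ (hKΩ n)
  let R : ℕ → ℝ := fun n => min (δ n / 2) (1 / ((n : ℝ) + 1))
  have hR : ∀ n, 0 < R n := fun n => lt_min (half_pos (hδ n)) (by positivity)
  let ρ : ℕ → ContDiffBump (0 : EuclideanSpace ℝ (Fin d)) := fun n =>
    ⟨R n / 2, R n, half_pos (hR n), half_lt_self (hR n)⟩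
  refine ⟨fun n => mollify (ρ n) Ω u, fun n => interior (K n),
    fun n => contDiff_mollify _ hΩ.measurableSet hu, fun n => isOpen_interior, hKS,
    fun n => ?_, ?_⟩
  · refine (lintegral_mono_set interior_subset).trans
      (lintegral_enorm_fderiv_mollify_le (ρ n) hΩ.measurableSet hu (hK n)
        (Subset.trans (Metric.cthickening_mono ?_ _) (hδΩ n)))
    have : R n ≤ δ n / 2 := min_le_left _ _
    change 2 * R n ≤ δ n
    linarith
  · have hR0 : Filter.Tendsto R Filter.atTop (nhds 0) :=
      squeeze_zero (fun n => (hR n).le) (fun n => min_le_right _ _)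
        tendsto_one_div_add_atTop_nhds_zero_nat
    have h := ContDiffBump.ae_convolution_tendsto_right_of_locallyIntegrable (φ := ρ) (K := 2)
      (μ := volume) hR0 (.of_forall fun n => by change R n ≤ 2 * (R n / 2); linarith)
      ((integrable_indicator_iff hΩ.measurableSet).2 hu).locallyIntegrable
    filter_upwards [ae_restrict_of_ae h, ae_restrict_mem hΩ.measurableSet] with x hx hxΩ
    rw [indicator_of_mem hxΩ] at hx
    exact hx

/-- The core estimate. The speed bound `L` is only needed when `u` has nonzero variation, as
otherwise the derivatives of the approximations vanish along the curves. -/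
theorem lintegral_enorm_comp_sub_le (hΩ : IsOpen Ω) (hu : IntegrableOn u Ω)
    {Φ : ℝ → EuclideanSpace ℝ (Fin d) → EuclideanSpace ℝ (Fin d)}
    (hΦΩ : ∀ s ∈ Icc (0 : ℝ) 1, MapsTo (Φ s) Ω Ω)
    (hmeas : ∀ s ∈ Icc (0 : ℝ) 1, AEMeasurable (Φ s) (volume.restrict Ω))
    (hdiff : ∀ x ∈ Ω, DifferentiableOn ℝ (fun s => Φ s x) (Icc (0 : ℝ) 1))
    {c L : ℝ≥0}
    (hpush : ∀ s ∈ Icc (0 : ℝ) 1,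
      Measure.map (Φ s) (volume.restrict Ω) ≤ c • volume.restrict Ω)
    (hspeed : totalVariation u Ω ≠ 0 → ∀ s ∈ Icc (0 : ℝ) 1, ∀ x ∈ Ω,
      ‖derivWithin (fun t => Φ t x) (Icc (0 : ℝ) 1) s‖ ≤ L) :
    ∫⁻ x in Ω, ‖u (Φ 1 x) - u (Φ 0 x)‖ₑ ≤ c * L * totalVariation u Ω := by
  obtain ⟨v, O, hv, hO, hOS, hvTV, hvu⟩ := exists_contDiff_approximation hΩ hu
  let D : ℕ → EuclideanSpace ℝ (Fin d) → ℝ≥0∞ := fun n =>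
    (O n).indicator fun y => ‖fderiv ℝ (v n) y‖ₑ
  have hDm : ∀ n, Measurable (D n) := fun n =>
    ((hv n).continuous_fderiv one_ne_zero).enorm.measurable.indicator (hO n).measurableSet
  have hDTV : ∀ n, ∫⁻ y in Ω, D n y ≤ totalVariation u Ω := fun n => by
    refine (lintegral_mono' Measure.restrict_le_self le_rfl).trans ?_
    rw [lintegral_indicator (hO n).measurableSet]
    exact hvTV n
  have hcont : ∀ x ∈ Ω, Continuous fun s => Φ (projIcc (0 : ℝ) 1 zero_le_one s) x := fun x hx =>
    (continuousOn_iff_continuous_domRestrict.1 (hdiff x hx).continuousOn).comp continuous_projIcc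
  obtain ⟨Ψ, hΨm, hΨ⟩ := exists_measurable_uncurry_of_continuous (μ := volume.restrict Ω)
    (F := fun s x => Φ (projIcc (0 : ℝ) 1 zero_le_one s) x)
    (fun s => hmeas _ (projIcc (0 : ℝ) 1 zero_le_one s).2)
    ((ae_restrict_mem hΩ.measurableSet).mono hcont)
  let G : ℕ → EuclideanSpace ℝ (Fin d) → ℝ≥0∞ := fun n x => L * ∫⁻ s in Icc (0 : ℝ) 1, D n (Ψ s x)
  have hGm : ∀ n, Measurable (G n) := fun n =>
    (Measurable.lintegral_prod_left' ((hDm n).comp hΨm)).const_mul _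
  have hG : ∀ n, ∫⁻ x in Ω, G n x ≤ c * L * totalVariation u Ω := fun n => by
    have hs : ∀ s ∈ Icc (0 : ℝ) 1, ∫⁻ x in Ω, D n (Ψ s x) ≤ c * totalVariation u Ω := by
      intro s hs
      calc ∫⁻ x in Ω, D n (Ψ s x) = ∫⁻ x in Ω, D n (Φ s x) := by
            refine lintegral_congr_ae (hΨ.mono fun x hx => ?_)
            simp only [hx s, projIcc_of_mem _ hs]
        _ = ∫⁻ y, D n y ∂Measure.map (Φ s) (volume.restrict Ω) :=
            (lintegral_map' (hDm n).aemeasurable (hmeas s hs)).symm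
        _ ≤ ∫⁻ y, D n y ∂(c • volume.restrict Ω) := lintegral_mono' (hpush s hs) le_rfl
        _ = c * ∫⁻ y in Ω, D n y := lintegral_smul_measure c _
        _ ≤ c * totalVariation u Ω := by gcongr; exact hDTV n
    calc ∫⁻ x in Ω, G n x
        = L * ∫⁻ x in Ω, ∫⁻ s in Icc (0 : ℝ) 1, D n (Ψ s x) :=
          lintegral_const_mul' _ _ ENNReal.coe_ne_top
      _ = L * ∫⁻ s in Icc (0 : ℝ) 1, ∫⁻ x in Ω, D n (Ψ s x) := by
          rw [lintegral_lintegral_swap]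
          exact ((hDm n).comp (hΨm.comp measurable_swap)).aemeasurable
      _ ≤ L * ∫⁻ _ in Icc (0 : ℝ) 1, c * totalVariation u Ω := by
          gcongr 1
          exact setLIntegral_mono' measurableSet_Icc hs
      _ = c * L * totalVariation u Ω := by
          rw [setLIntegral_const, Real.volume_Icc]
          simp only [sub_zero, ENNReal.ofReal_one, mul_one]
          ring
  have hvΦ : ∀ s ∈ Icc (0 : ℝ) 1, ∀ᵐ x ∂volume.restrict Ω,
      Filter.Tendsto (fun n => v n (Φ s x)) Filter.atTop (nhds (u (Φ s x))) := fun s hs =>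
    ae_of_ae_map (hmeas s hs)
      (((Measure.absolutelyContinuous_of_le (hpush s hs)).trans
        Measure.smul_absolutelyContinuous).ae_le hvu)
  have hpt : ∀ᵐ x ∂volume.restrict Ω,
      ‖u (Φ 1 x) - u (Φ 0 x)‖ₑ ≤ Filter.liminf (fun n => G n x) Filter.atTop := by
    filter_upwards [hΨ, hvΦ 0 (by simp), hvΦ 1 (by simp), ae_restrict_mem hΩ.measurableSet]
      with x hx h0 h1 hxΩ
    rw [← (h1.sub h0).enorm.liminf_eq]
    refine Filter.liminf_le_liminf ?_
    have hS : IsCompact ((fun s => Φ s x) '' Icc (0 : ℝ) 1) :=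
      isCompact_Icc.image_of_continuousOn (hdiff x hxΩ).continuousOn
    filter_upwards [hOS _ hS (image_subset_iff.2 fun s hs => hΦΩ s hs hxΩ)] with n hn
    refine (enorm_sub_le_lintegral_fderiv (hv n) (hdiff x hxΩ) (L := L) fun s hs => ?_).trans_eq ?_
    · by_cases hTV : totalVariation u Ω = 0
      · -- A vanishing `L₁` norm forces the continuous derivative to vanish on the open set `O n`.
        have hz : fderiv ℝ (v n) (Φ s x) = 0 := by
          have hc := (hv n).continuous_fderiv one_ne_zero
          have h2 : ∫⁻ y in O n, ‖fderiv ℝ (v n) y‖ₑ = 0 :=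
            le_antisymm ((hvTV n).trans hTV.le) zero_le
          rw [lintegral_eq_zero_iff hc.enorm.measurable] at h2
          refine Measure.eqOn_open_of_ae_eq (μ := volume) (g := fun _ => 0) ?_ (hO n)
            hc.continuousOn continuousOn_const (hn (mem_image_of_mem _ hs))
          filter_upwards [h2] with y hy
          exact norm_eq_zero.1 ((toReal_enorm _).symm.trans (congrArg ENNReal.toReal hy))
        simp [hz]
      · rw [mul_comm]
        exact mul_le_mul_of_nonneg_right (hspeed hTV s hs x hxΩ) (norm_nonneg _)
    · refine congrArg _ (setLIntegral_congr_fun measurableSet_Icc fun s hs => ?_)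
      simp only [hx s, projIcc_of_mem _ hs, D, indicator_of_mem (hn (mem_image_of_mem _ hs))]
  calc ∫⁻ x in Ω, ‖u (Φ 1 x) - u (Φ 0 x)‖ₑ
      ≤ ∫⁻ x in Ω, Filter.liminf (fun n => G n x) Filter.atTop := lintegral_mono_ae hpt
    _ ≤ Filter.liminf (fun n => ∫⁻ x in Ω, G n x) Filter.atTop :=
        lintegral_liminf_le' fun n => (hGm n).aemeasurable
    _ ≤ c * L * totalVariation u Ω :=
        Filter.liminf_le_of_frequently_le' (Filter.Frequently.of_forall hG)

end Perturbation

end BVPerturbation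

theorem mainTheorem2 (d : ℕ) (Ω : Set (EuclideanSpace ℝ (Fin d))) (hΩ : IsOpen Ω)
    (u : EuclideanSpace ℝ (Fin d) → ℝ) (hu : BVPerturbation.MemBV u Ω)
    (φ ϕ : EuclideanSpace ℝ (Fin d) → EuclideanSpace ℝ (Fin d))
    (Φ : ℝ → EuclideanSpace ℝ (Fin d) → EuclideanSpace ℝ (Fin d))
    (hΦΩ : ∀ s ∈ Icc (0 : ℝ) 1, MapsTo (Φ s) Ω Ω)
    (hΦ0 : ∀ x ∈ Ω, Φ 0 x = φ x) (hΦ1 : ∀ x ∈ Ω, Φ 1 x = ϕ x)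
    (hmeas : ∀ s ∈ Icc (0 : ℝ) 1, AEMeasurable (Φ s) (volume.restrict Ω))
    (hdiff : ∀ x ∈ Ω, DifferentiableOn ℝ (fun s => Φ s x) (Icc (0 : ℝ) 1))
    (c C : ℝ≥0)
    (hpush : ∀ s ∈ Icc (0 : ℝ) 1,
      Measure.map (Φ s) (volume.restrict Ω) ≤ c • volume.restrict Ω)
    (hspeed : ∀ s ∈ Icc (0 : ℝ) 1, ∀ x ∈ Ω,
      ‖derivWithin (fun t => Φ t x) (Icc (0 : ℝ) 1) s‖ₑ
        ≤ C * eLpNorm (fun y => φ y - ϕ y) ∞ (volume.restrict Ω)) :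
    IntegrableOn (fun x => u (φ x) - u (ϕ x)) Ω ∧
    eLpNorm (fun x => u (φ x) - u (ϕ x)) 1 (volume.restrict Ω)
      ≤ c * C * BVPerturbation.totalVariation u Ω
          * eLpNorm (fun y => φ y - ϕ y) ∞ (volume.restrict Ω) ∧
    eLpNorm (fun x => u (φ x) - u (ϕ x)) 1 (volume.restrict Ω)
      ≤ c * C * BVPerturbation.bvNorm u Ω
          * eLpNorm (fun y => φ y - ϕ y) ∞ (volume.restrict Ω) := by
  set M := eLpNorm (fun y => φ y - ϕ y) ∞ (volume.restrict Ω)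
  set V := BVPerturbation.totalVariation u Ω
  have hint : ∀ s ∈ Icc (0 : ℝ) 1, IntegrableOn (fun x => u (Φ s x)) Ω := fun s hs =>
    Integrable.comp_aemeasurable
      ((hu.integrableOn.smul_measure_nnreal (c := c)).mono_measure (hpush s hs)) (hmeas s hs)
  have hcore : eLpNorm (fun x => u (φ x) - u (ϕ x)) 1 (volume.restrict Ω) ≤ c * C * V * M := by
    have heq : eLpNorm (fun x => u (φ x) - u (ϕ x)) 1 (volume.restrict Ω)
        = ∫⁻ x in Ω, ‖u (Φ 1 x) - u (Φ 0 x)‖ₑ := by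
      rw [eLpNorm_one_eq_lintegral_enorm]
      refine setLIntegral_congr_fun hΩ.measurableSet fun x hx => ?_
      simp only [hΦ0 x hx, hΦ1 x hx]
      rw [← enorm_neg, neg_sub]
    rw [heq]
    by_cases hc : c = 0
    · -- A push-forward of total mass zero means that `Ω` itself is null.
      have h0 : Measure.map (Φ 0) (volume.restrict Ω) = 0 :=
        le_antisymm ((hpush 0 (by simp)).trans_eq (by simp [hc])) (Measure.zero_le _)
      rw [Measure.map_eq_zero_iff (hmeas 0 (by simp))] at h0
      simp [h0]
    by_cases hVz : V = 0
    · refine (BVPerturbation.lintegral_enorm_comp_sub_le hΩ hu.integrableOn hΦΩ hmeas hdiff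
        (L := 0) hpush fun h => absurd hVz h).trans ?_
      simp
    by_cases hCM : C * M = ∞
    · have : (c : ℝ≥0∞) * C * V * M = ∞ := by
        rw [show (c : ℝ≥0∞) * C * V * M = c * V * (C * M) by ring, hCM]
        exact ENNReal.mul_top (mul_ne_zero (by exact_mod_cast hc) hVz)
      rw [this]
      exact le_top
    · refine (BVPerturbation.lintegral_enorm_comp_sub_le hΩ hu.integrableOn hΦΩ hmeas hdiff
        (L := (C * M).toNNReal) hpush fun _ s hs x hx => ?_).trans_eq ?_
      · have h := hspeed s hs x hx
        rw [← ENNReal.coe_toNNReal hCM, enorm_le_coe] at h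
        exact_mod_cast h
      · rw [ENNReal.coe_toNNReal hCM]
        ring
  refine ⟨?_, hcore, hcore.trans ?_⟩
  · refine ((hint 0 (by simp)).sub (hint 1 (by simp))).congr ?_
    filter_upwards [ae_restrict_mem hΩ.measurableSet] with x hx
    simp [hΦ0 x hx, hΦ1 x hx]
  · gcongr
    exact le_add_self
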